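/- Let $f_0=f_1=1$ and $f_n=f_{n-1}+f_{n-2}$ for $n\ge 2$, let $r,s\in\mathbb R\setminus\{0\}$, and let $\hat F(r,s)$ be the infinite matrix (rows and columns indexed by $\mathbb N=\{0,1,2,\dots\}$) with entries $r\frac{f_n}{f_{n+1}}$ for $k=n$, $s\frac{f_{n+1}}{f_n}$ for $k=n-1$, and $0$ otherwise. For $1<p\le\infty$ let $l_p(\hat F(r,s))$ be the set of real sequences $x=(x_k)_{k\ge0}$ such that $\hat F(r,s)x\in l_p$. Let $c$ be the space of convergent real sequences. For sets $X,Y$ of real sequences, $(X,Y)$ is the class of infinite real matrices $A=(a_{nk})_{n,k\ge0}$ such that for every $x\in X$ all the series $(Ax)_n=\sum_{k=0}^\infty a_{nk}x_k$ converge and $Ax\in Y$. Let $A=(a_{nk})$ be an infinite real matrix, and for $k,m,n\in\mathbb N$ put $$d^{(m)}_{nk}=\begin{cases}\displaystyle\sum_{j=k}^{m}\frac1r\Big(-\frac sr\Big)^{j-k}\frac{f_{j+1}^2}{f_kf_{k+1}}a_{nj},&0\le k\le m,\\ 0,&k>m,\end{cases}\qquad d_{nk}=\sum_{j=k}^{\infty}\frac1r\Big(-\frac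 sr\Big)^{j-k}\frac{f_{j+1}^2}{f_kf_{k+1}}a_{nj}.$$ Consider the following conditions, in which $q>0$ is a parameter: 1. for every $n$: $\ \sup_m\sum_k|d^{(m)}_{nk}|^q<\infty$; 2. for all $n$ and $k$: $\ \lim_{m\to\infty}d^{(m)}_{nk}$ exists in $\mathbb R$ (equivalently, the series defining $d_{nk}$ converges); 3. for every $n$: $\ \lim_{m\to\infty}\sum_k|d^{(m)}_{nk}|=\sum_k\big|\lim_{m\to\infty}d^{(m)}_{nk}\big|<\infty$; 4. $\sup_n\sum_k|d_{nk}|^q<\infty$; 5. for every $k$: $\ \lim_{n\to\infty}d_{nk}$ exists in $\mathbb R$; 6. $\lim_{n\to\infty}\sum_k|d_{nk}|=\sum_k\big|\lim_{n\to\infty}d_{nk}\big|<\infty$, with $\sum_k|d_{nk}|<\infty$ for every $n$; 7. $\sup_{K}\sum_k\big|\sum_{n\in K}d_{nk}\big|^q<\infty$, the supremum being over all finite $K\subset\mathbb N$. (Every list below contains condition 2, so that the numbers $d_{nk}$ are defined.) Then the following hold, where in (a), (b), (d) $1<p<\infty$ and $q=\frac p{p-1}$, and in (e), (f) $q=1$: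 (a) $A\in(l_p(\hat F(r,s)),c)$ if and only if 1, 2, 4 and 5 hold. (b) $A\in(l_p(\hat F(r,s)),l_1)$ if and only if 1, 2 and 7 hold. (c) $A\in(l_\infty(\hat F(r,s)),c)$ if and only if 2, 3, 5 and 6 hold. (d) $A\in(l_p(\hat F(r,s)),l_\infty)$ if and only if 1, 2 and 4 hold. (e) $A\in(l_\infty(\hat F(r,s)),l_1)$ if and only if 2, 3 and 7 hold. (f) $A\in(l_\infty(\hat F(r,s)),l_\infty)$ if and only if 2, 3 and 4 hold. -/

import Mathlib

open Filter Topology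
open scoped ENNReal

/-- The Fibonacci numbers with `f 0 = f 1 = 1`, as real numbers. -/
def fibSeq (n : ℕ) : ℝ := (Nat.fib (n + 1) : ℝ)

/-- `y` is the `A`-transform of `x`: for every `n` the series `∑ k, A n k * x k` converges
(as an ordinary, possibly only conditionally convergent series), with sum `y n`. -/
def IsTransform (A : Matrix ℕ ℕ ℝ) (x y : ℕ → ℝ) : Prop :=
  ∀ n, Tendsto (fun N : ℕ => ∑ k ∈ Finset.range N, A n k * x k) atTop (𝓝 (y n))

/-- The matrix domain of `A` in `X`: the sequences `x` whose `A`-transform exists and lies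
in `X`. -/
def matrixDomain (A : Matrix ℕ ℕ ℝ) (X : Set (ℕ → ℝ)) : Set (ℕ → ℝ) :=
  {x | ∃ y ∈ X, IsTransform A x y}

/-- The class `(X, Y)` of the matrices `A` such that, for every `x ∈ X`, the `A`-transform of
`x` exists and lies in `Y`. -/
def matrixClass (X Y : Set (ℕ → ℝ)) : Set (Matrix ℕ ℕ ℝ) :=
  {A | ∀ x ∈ X, x ∈ matrixDomain A Y}

/-- The space of real sequences `l_p`, `0 < p ≤ ∞` (for `p = ∞` the bounded sequences). -/
def seqL (p : ℝ≥0∞) : Set (ℕ → ℝ) := {x | Memℓp x p}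

/-- The space `c` of convergent real sequences. -/
def seqC : Set (ℕ → ℝ) := {x | ∃ l : ℝ, Tendsto x atTop (𝓝 l)}

/-- The Fibonacci band matrix `F̂(r,s)`. -/
noncomputable def fibMatrix (r s : ℝ) : Matrix ℕ ℕ ℝ := fun n k =>
  if k = n then r * (fibSeq n / fibSeq (n + 1))
  else if k + 1 = n then s * (fibSeq (n + 1) / fibSeq n)
  else 0

/-- The space `l_p(F̂(r,s))`, the matrix domain of `F̂(r,s)` in `l_p`. -/
noncomputable def fibL (p : ℝ≥0∞) (r s : ℝ) : Set (ℕ → ℝ) :=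
  matrixDomain (fibMatrix r s) (seqL p)

/-- For fixed `n`, the matrix with entry `d_{nk}^{(m)}` in row `m` and column `k`. -/
noncomputable def matDm (r s : ℝ) (A : Matrix ℕ ℕ ℝ) (n : ℕ) : Matrix ℕ ℕ ℝ := fun m k =>
  if k ≤ m then
    ∑ j ∈ Finset.Icc k m,
      1 / r * (-(s / r)) ^ (j - k) * (fibSeq (j + 1) ^ 2 / (fibSeq k * fibSeq (k + 1))) * A n j
  else 0

/-- The matrix `D = (d_{nk})`, whose entry `d_{nk}` is the sum of the infinite series over
`j ≥ k`, that is, the limit of the partial sums from `j = k` to `j = m` as `m → ∞`. This is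
meaningful when these limits exist, that is, when `HasColLimits (matDm r s A n)` for all `n`. -/
noncomputable def matD (r s : ℝ) (A : Matrix ℕ ℕ ℝ) : Matrix ℕ ℕ ℝ := fun n k =>
  limUnder atTop (fun m : ℕ =>
    ∑ j ∈ Finset.Icc k m,
      1 / r * (-(s / r)) ^ (j - k) * (fibSeq (j + 1) ^ 2 / (fibSeq k * fibSeq (k + 1))) * A n j)

/-- `sup_n ∑_k |b_{nk}|^q < ∞`. -/
def SupRowSums (q : ℝ) (B : Matrix ℕ ℕ ℝ) : Prop :=
  ⨆ n, ∑' k, ‖B n k‖ₑ ^ q < ∞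

/-- `lim_n b_{nk}` exists for every `k`. -/
def HasColLimits (B : Matrix ℕ ℕ ℝ) : Prop :=
  ∀ k, ∃ l : ℝ, Tendsto (fun n => B n k) atTop (𝓝 l)

/-- `lim_n ∑_k |b_{nk}| = ∑_k |lim_n b_{nk}|`, where the column limits exist and all the sums
are finite. -/
def LimRowSums (B : Matrix ℕ ℕ ℝ) : Prop :=
  ∃ b : ℕ → ℝ, (∀ k, Tendsto (fun n => B n k) atTop (𝓝 (b k))) ∧
    (∀ n, Summable fun k => |B n k|) ∧ (Summable fun k => |b k|) ∧
    Tendsto (fun n => ∑' k, |B n k|) atTop (𝓝 (∑' k, |b k|))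

/-- `sup_K ∑_k |∑_{n ∈ K} b_{nk}|^q < ∞`, the supremum being over the finite sets `K ⊆ ℕ`. -/
def SupFinsetSums (q : ℝ) (B : Matrix ℕ ℕ ℝ) : Prop :=
  ⨆ K : Finset ℕ, ∑' k, ‖∑ n ∈ K, B n k‖ₑ ^ q < ∞

/-! The matrix `F̂(r,s)` is lower bidiagonal with nonzero diagonal, so `x ↦ y = F̂x` is a bijection
of `l_p(F̂)` onto `l_p`, with the explicit triangular inverse `fibInv`. Substituting this inverse
into a partial sum of `(Ax)_n` gives `∑_{j ≤ m} a_{nj} x_j = ∑_{k ≤ m} d^{(m)}_{nk} y_k`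
(`sum_matDm_mul`). Hence the series `(Ax)_n` converges for all `x` exactly when the matrix
`(d^{(m)}_{nk})_{m,k}` lies in `(l_p, c)`. For matrices in `(l_p, c)` the limit of the transform is
computed column by column, so `(Ax)_n = ∑_k d_{nk} y_k`. Thus `A` acts from `l_p(F̂)` to `Y` iff
these matrices are in `(l_p, c)` for every `n` and `D` is in `(l_p, Y)`
(`mem_matrixClass_fibL_iff`).

What remains are the classical descriptions of `(l_p, Y)`. For `Y = l_∞` and `Y = l_1` they come
from Hölder's inequality, its converse and the uniform boundedness principle. For `Y = c` and `p <
∞`, convergence of the columns is added, and finitely supported sequences are dense. For `(l_∞, c)`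
density fails, and Schur's theorem takes its place, proved by Baire category on sign sequences. -/

/-- `q` is the real conjugate exponent of `p ∈ (1, ∞]`. -/
def SeqConjugate (p : ℝ≥0∞) (q : ℝ) : Prop :=
  (∃ p' : ℝ, p = ENNReal.ofReal p' ∧ p'.HolderConjugate q) ∨ (p = ∞ ∧ q = 1)

theorem SeqConjugate.of_one_lt {p : ℝ} (hp : 1 < p) :
    SeqConjugate (ENNReal.ofReal p) (p / (p - 1)) :=
  Or.inl ⟨p, rfl, (Real.holderConjugate_iff_eq_conjExponent hp).2 rfl⟩

theorem SeqConjugate.top : SeqConjugate ∞ 1 := Or.inr ⟨rfl, rfl⟩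

theorem SeqConjugate.one_le {p : ℝ≥0∞} {q : ℝ} (h : SeqConjugate p q) : 1 ≤ p := by
  rcases h with ⟨p', rfl, h⟩ | ⟨rfl, -⟩
  · exact ENNReal.one_le_ofReal.2 h.lt.le
  · exact le_top

theorem SeqConjugate.pos {p : ℝ≥0∞} {q : ℝ} (h : SeqConjugate p q) : 0 < q := by
  rcases h with ⟨p', rfl, h⟩ | ⟨-, rfl⟩
  · exact h.symm.pos
  · exact one_pos

/-! ### Hölder duality between `l_p` and `l_q` -/

theorem enorm_rpow_eq_ofReal (b : ℝ) {q : ℝ} (hq : 0 ≤ q) :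
    ‖b‖ₑ ^ q = ENNReal.ofReal (|b| ^ q) := by
  rw [← ofReal_norm, Real.norm_eq_abs, ENNReal.ofReal_rpow_of_nonneg (abs_nonneg _) hq]

theorem summable_abs_rpow_of_tsum_le {q M : ℝ} (hq : 0 ≤ q) (hM : 0 ≤ M) {b : ℕ → ℝ}
    (h : ∑' k, ‖b k‖ₑ ^ q ≤ ENNReal.ofReal M) :
    (Summable fun k => |b k| ^ q) ∧ ∑' k, |b k| ^ q ≤ M := by
  simp_rw [enorm_rpow_eq_ofReal _ hq] at h
  have hb : ∀ N : Finset ℕ, ∑ k ∈ N, |b k| ^ q ≤ M := fun N => by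
    have := (ENNReal.sum_le_tsum (f := fun k => ENNReal.ofReal (|b k| ^ q)) N).trans h
    rwa [← ENNReal.ofReal_sum_of_nonneg (fun _ _ => by positivity),
      ENNReal.ofReal_le_ofReal_iff hM] at this
  have hs := summable_of_sum_le (fun k => by positivity) hb
  exact ⟨hs, hs.tsum_le_of_sum_le hb⟩

/-- Hölder's inequality for the pairing of a sequence with `l_p`. -/
theorem summable_mul_of_tsum_le {p : ℝ≥0∞} {q : ℝ} (h : SeqConjugate p q) {C : ℝ} (hC : 0 ≤ C)
    {b : ℕ → ℝ} (hb : ∑' k, ‖b k‖ₑ ^ q ≤ ENNReal.ofReal (C ^ q)) (y : lp (fun _ : ℕ => ℝ) p) :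
    (Summable fun k => |b k * y k|) ∧ ∑' k, |b k * y k| ≤ C * ‖y‖ := by
  obtain ⟨hs, hle⟩ := summable_abs_rpow_of_tsum_le h.pos.le (by positivity) hb
  rcases h with ⟨p', rfl, h⟩ | ⟨rfl, rfl⟩
  · have hp : (ENNReal.ofReal p').toReal = p' := ENNReal.toReal_ofReal h.nonneg
    have hy := (lp.memℓp y).summable (by rw [hp]; exact h.pos)
    have hn := lp.norm_eq_tsum_rpow (by rw [hp]; exact h.pos) y
    rw [hp] at hy hn
    obtain ⟨h1, h2⟩ := Real.summable_and_inner_le_Lp_mul_Lq_tsum_of_nonneg h.symm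
      (f := fun k => |b k|) (g := fun k => ‖y k‖) (fun _ => abs_nonneg _) (fun _ => norm_nonneg _)
      hs hy
    simp_rw [abs_mul]
    refine ⟨h1, h2.trans ?_⟩
    rw [hn]
    refine mul_le_mul_of_nonneg_right ?_ (by positivity)
    calc (∑' k, |b k| ^ q) ^ (1 / q) ≤ (C ^ q) ^ (1 / q) :=
          Real.rpow_le_rpow (tsum_nonneg fun _ => by positivity) hle (by
            have := h.symm.pos; positivity)
      _ = C := by rw [one_div, Real.rpow_rpow_inv hC h.symm.ne_zero]
  · simp only [Real.rpow_one] at hs hle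
    have hy : ∀ k, |b k * y k| ≤ |b k| * ‖y‖ := fun k => by
      rw [abs_mul]
      exact mul_le_mul_of_nonneg_left (lp.norm_apply_le_norm ENNReal.top_ne_zero y k)
        (abs_nonneg _)
    have h1 := Summable.of_nonneg_of_le (fun _ => abs_nonneg _) hy (hs.mul_right _)
    refine ⟨h1, (h1.tsum_le_tsum hy (hs.mul_right _)).trans ?_⟩
    rw [tsum_mul_right]
    exact mul_le_mul_of_nonneg_right hle (norm_nonneg _)

/-- The constant is the `q`-th root of the supremum. The index type is free so that it can be the
rows of a matrix or the finite sets of rows. -/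
theorem exists_bound_of_iSup_lt_top {p : ℝ≥0∞} {q : ℝ} (h : SeqConjugate p q) {ι : Type*}
    {b : ι → ℕ → ℝ} (hb : ⨆ i, ∑' k, ‖b i k‖ₑ ^ q < ∞) :
    ∃ C : ℝ, 0 ≤ C ∧ ∀ i (y : lp (fun _ : ℕ => ℝ) p),
      (Summable fun k => |b i k * y k|) ∧ ∑' k, |b i k * y k| ≤ C * ‖y‖ := by
  refine ⟨(⨆ i, ∑' k, ‖b i k‖ₑ ^ q).toReal ^ q⁻¹, by positivity, fun i y =>
    summable_mul_of_tsum_le h (by positivity) ?_ y⟩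
  rw [Real.rpow_inv_rpow ENNReal.toReal_nonneg h.pos.ne', ENNReal.ofReal_toReal hb.ne]
  exact le_iSup (fun i => ∑' k, ‖b i k‖ₑ ^ q) i

/-- The converse of Hölder's inequality, tested on finitely supported sequences. -/
theorem sum_rpow_le_of_forall {p : ℝ≥0∞} {q : ℝ} (h : SeqConjugate p q) {C : ℝ} (hC : 0 ≤ C)
    {b : ℕ → ℝ} (N : ℕ) (hb : ∀ y : lp (fun _ : ℕ => ℝ) p, (∀ k, N ≤ k → y k = 0) →
      |∑ k ∈ Finset.range N, b k * y k| ≤ C * ‖y‖) :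
    ∑ k ∈ Finset.range N, |b k| ^ q ≤ C ^ q := by
  -- The extremal sequence for Hölder's inequality, cut off at `N`. For `q = 1` the power is
  -- identically `1`, also at `0`, and only the sign is left.
  set v : ℕ → ℝ := fun k => if k < N then SignType.sign (b k) * |b k| ^ (q - 1) else 0 with hv
  have hv0 : ∀ k, N ≤ k → v k = 0 := fun k hk => by simp [hv, not_lt.2 hk]
  have hvm : Memℓp v p := by
    refine (memℓp_zero ((Finset.range N).finite_toSet.subset fun k hk => ?_)).of_exponent_ge
      zero_le
    by_contra hkN
    exact hk (hv0 k (by simpa using hkN))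
  have hS : ∑ k ∈ Finset.range N, b k * v k = ∑ k ∈ Finset.range N, |b k| ^ q := by
    refine Finset.sum_congr rfl fun k hk => ?_
    simp only [hv, Finset.mem_range.1 hk, if_true]
    rw [← mul_assoc, self_mul_sign]
    rcases eq_or_ne (b k) 0 with h0 | h0
    · simp [h0, Real.zero_rpow h.pos.ne']
    · nth_rw 1 [← Real.rpow_one |b k|]
      rw [← Real.rpow_add (abs_pos.2 h0), add_sub_cancel]
  have hmain := hb ⟨v, hvm⟩ hv0
  change |∑ k ∈ Finset.range N, b k * v k| ≤ _ at hmain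
  rw [hS] at hmain
  have hmain := (le_abs_self _).trans hmain
  have hsgn : ∀ k, |((SignType.sign (b k) : SignType) : ℝ)| ≤ 1 := fun k => by
    rcases lt_trichotomy (b k) 0 with h0 | h0 | h0 <;> simp [h0]
  rcases h with ⟨p', rfl, h⟩ | ⟨rfl, rfl⟩
  · have hp : (ENNReal.ofReal p').toReal = p' := ENNReal.toReal_ofReal h.nonneg
    set S := ∑ k ∈ Finset.range N, |b k| ^ q with hSdef
    have hS0 : 0 ≤ S := Finset.sum_nonneg fun _ _ => by positivity
    have hn : ‖(⟨v, hvm⟩ : lp (fun _ : ℕ => ℝ) (ENNReal.ofReal p'))‖ ≤ S ^ (1 / p') := by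
      rw [lp.norm_eq_tsum_rpow (by rw [hp]; exact h.pos), hp]
      refine Real.rpow_le_rpow (tsum_nonneg fun _ => by positivity) ?_ (by
        have := h.pos; positivity)
      rw [tsum_eq_sum (s := Finset.range N)]
      · refine Finset.sum_le_sum fun k hk => ?_
        simp only [hv, Finset.mem_range.1 hk, if_true, Real.norm_eq_abs, abs_mul]
        rw [Real.mul_rpow (abs_nonneg _) (abs_nonneg _),
          abs_of_nonneg (Real.rpow_nonneg (abs_nonneg (b k)) (q - 1)),
          ← Real.rpow_mul (abs_nonneg _), h.symm.sub_one_mul_conj]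
        exact mul_le_of_le_one_left (by positivity)
          (Real.rpow_le_one (abs_nonneg _) (hsgn k) h.nonneg)
      · intro k hk
        simp only [hv0 k (by simpa using hk), norm_zero]
        exact Real.zero_rpow h.ne_zero
    -- The final estimate divides by `S ^ (1 / p')`, so `S = 0` is treated apart.
    rcases hS0.eq_or_lt with h0 | h0
    · rw [← h0]; positivity
    · have h1 : S ≤ C * S ^ (1 / p') := hmain.trans (mul_le_mul_of_nonneg_left hn hC)
      have h2 : S ^ (1 / q) ≤ C := by
        have h3 : S = S ^ (1 / q) * S ^ (1 / p') := by
          rw [← Real.rpow_add h0, one_div, one_div, h.symm.inv_add_inv_eq_one, Real.rpow_one]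
        exact le_of_mul_le_mul_right (h3.symm.trans_le h1) (Real.rpow_pos_of_pos h0 _)
      calc S = (S ^ (1 / q)) ^ q := by rw [one_div, Real.rpow_inv_rpow hS0 h.symm.ne_zero]
        _ ≤ C ^ q := Real.rpow_le_rpow (by positivity) h2 h.symm.nonneg
  · have hn : ‖(⟨v, hvm⟩ : lp (fun _ : ℕ => ℝ) ∞)‖ ≤ 1 := by
      refine lp.norm_le_of_forall_le zero_le_one fun k => ?_
      by_cases hk : k < N
      · simpa [hv, hk] using hsgn k
      · simp [hv, hk]
    simp only [Real.rpow_one] at hmain ⊢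
    exact hmain.trans (mul_le_of_le_one_right hC hn)

theorem iSup_lt_top_of_forall {p : ℝ≥0∞} {q : ℝ} (h : SeqConjugate p q) {ι : Type*}
    {b : ι → ℕ → ℝ} {C : ℝ} (hC : 0 ≤ C) (hb : ∀ i N (y : lp (fun _ : ℕ => ℝ) p),
      (∀ k, N ≤ k → y k = 0) → |∑ k ∈ Finset.range N, b i k * y k| ≤ C * ‖y‖) :
    ⨆ i, ∑' k, ‖b i k‖ₑ ^ q < ∞ := by
  refine (iSup_le fun i => ?_).trans_lt (ENNReal.ofReal_lt_top (r := C ^ q))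
  rw [ENNReal.tsum_eq_iSup_nat]
  refine iSup_le fun N => ?_
  simp_rw [enorm_rpow_eq_ofReal _ h.pos.le]
  rw [← ENNReal.ofReal_sum_of_nonneg (fun _ _ => by positivity)]
  exact ENNReal.ofReal_le_ofReal (sum_rpow_le_of_forall h hC N (hb i N))

/-! ### Uniform boundedness -/

/-- The functional `y ↦ ∑ k < N, b k * y k` on `l_p`. -/
noncomputable def partialSumCLM (p : ℝ≥0∞) [Fact (1 ≤ p)] (b : ℕ → ℝ) (N : ℕ) :
    lp (fun _ : ℕ => ℝ) p →L[ℝ] ℝ :=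
  ∑ k ∈ Finset.range N, b k • lp.evalCLM ℝ (fun _ : ℕ => ℝ) p k

theorem partialSumCLM_apply (p : ℝ≥0∞) [Fact (1 ≤ p)] (b : ℕ → ℝ) (N : ℕ)
    (y : lp (fun _ : ℕ => ℝ) p) :
    partialSumCLM p b N y = ∑ k ∈ Finset.range N, b k * y k := by
  simp [partialSumCLM]
  rfl

/-- By Banach–Steinhaus, a pointwise limit of continuous functionals on a Banach space is
continuous. -/
theorem exists_clm_of_tendsto (p : ℝ≥0∞) [Fact (1 ≤ p)] {b : ℕ → ℝ}
    (hb : ∀ y : lp (fun _ : ℕ => ℝ) p,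
      ∃ l : ℝ, Tendsto (fun N => ∑ k ∈ Finset.range N, b k * y k) atTop (𝓝 l)) :
    ∃ φ : lp (fun _ : ℕ => ℝ) p →L[ℝ] ℝ, ∀ y,
      Tendsto (fun N => ∑ k ∈ Finset.range N, b k * y k) atTop (𝓝 (φ y)) := by
  choose f hf using hb
  refine ⟨continuousLinearMapOfTendsto (partialSumCLM p b) (f := f) (l := atTop) ?_, hf⟩
  rw [tendsto_pi_nhds]
  intro y
  simpa only [partialSumCLM_apply] using hf y

/-- The norms of the `φ i` are uniformly bounded. On finitely supported `y` each `φ i` is a finite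
sum, and the converse of Hölder's inequality applies. -/
theorem iSup_lt_top_of_pointwise_bounded {p : ℝ≥0∞} [Fact (1 ≤ p)] {q : ℝ}
    (h : SeqConjugate p q) {ι : Type*} {b : ι → ℕ → ℝ} (φ : ι → lp (fun _ : ℕ => ℝ) p →L[ℝ] ℝ)
    (hφ : ∀ i y, Tendsto (fun N => ∑ k ∈ Finset.range N, b i k * y k) atTop (𝓝 (φ i y)))
    (hb : ∀ y, ∃ C, ∀ i, |φ i y| ≤ C) :
    ⨆ i, ∑' k, ‖b i k‖ₑ ^ q < ∞ := by
  obtain ⟨C, hC⟩ := banach_steinhaus (g := φ) hb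
  refine iSup_lt_top_of_forall h (le_max_right C 0) fun i N y hy => ?_
  have : φ i y = ∑ k ∈ Finset.range N, b i k * y k := by
    refine tendsto_nhds_unique (hφ i y) (tendsto_const_nhds.congr' ?_)
    filter_upwards [eventually_ge_atTop N] with M hM
    refine Finset.sum_subset (Finset.range_mono hM) fun k _ hk => ?_
    rw [hy k (by simpa using hk), mul_zero]
  rw [← this]
  exact ((φ i).le_opNorm y).trans
    (mul_le_mul_of_nonneg_right ((hC i).trans (le_max_left _ _)) (norm_nonneg _))

/-- The nonnegative and the negative terms form two subsets of `K`, each contributing at most `M`.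
-/
theorem sum_abs_le_two_mul {z : ℕ → ℝ} {M : ℝ} (hz : ∀ K : Finset ℕ, |∑ n ∈ K, z n| ≤ M)
    (K : Finset ℕ) : ∑ n ∈ K, |z n| ≤ 2 * M := by
  rw [← Finset.sum_filter_add_sum_filter_not K (fun n => 0 ≤ z n)]
  have h1 : ∑ n ∈ K with 0 ≤ z n, |z n| = ∑ n ∈ K with 0 ≤ z n, z n :=
    Finset.sum_congr rfl fun n hn => abs_of_nonneg (Finset.mem_filter.1 hn).2
  have h2 : ∑ n ∈ K with ¬ 0 ≤ z n, |z n| = -∑ n ∈ K with ¬ 0 ≤ z n, z n := by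
    rw [← Finset.sum_neg_distrib]
    exact Finset.sum_congr rfl fun n hn =>
      abs_of_nonpos (not_le.1 (Finset.mem_filter.1 hn).2).le
  rw [h1, h2]
  have h3 := (le_abs_self _).trans (hz (K.filter fun n => 0 ≤ z n))
  have h4 := (neg_le_abs _).trans (hz (K.filter fun n => ¬ 0 ≤ z n))
  linarith

theorem tendsto_sum_of_summable_abs {f : ℕ → ℝ} (h : Summable fun k => |f k|) :
    Tendsto (fun N => ∑ k ∈ Finset.range N, f k) atTop (𝓝 (∑' k, f k)) :=
  h.of_abs.hasSum.tendsto_sum_nat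

theorem abs_tsum_le_tsum_abs {f : ℕ → ℝ} (h : Summable fun k => |f k|) :
    |∑' k, f k| ≤ ∑' k, |f k| := by
  simpa only [Real.norm_eq_abs] using norm_tsum_le_tsum_norm (f := f)
    (by simpa only [Real.norm_eq_abs] using h)

/-! ### The classes `(l_p, l_∞)`, `(l_p, l_1)` and `(l_p, c)` -/

/-- The functionals given by the rows of a matrix that acts on `l_p`. -/
theorem exists_row_clm {p : ℝ≥0∞} [Fact (1 ≤ p)] {B : Matrix ℕ ℕ ℝ} {Y : Set (ℕ → ℝ)}
    (hB : B ∈ matrixClass (seqL p) Y) :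
    ∃ φ : ℕ → lp (fun _ : ℕ => ℝ) p →L[ℝ] ℝ, ∀ y : lp (fun _ : ℕ => ℝ) p,
      IsTransform B y (fun n => φ n y) ∧ (fun n => φ n y) ∈ Y := by
  have h : ∀ n, ∀ y : lp (fun _ : ℕ => ℝ) p,
      ∃ l : ℝ, Tendsto (fun N => ∑ k ∈ Finset.range N, B n k * y k) atTop (𝓝 l) := fun n y => by
    obtain ⟨z, -, hz⟩ := hB y (lp.memℓp y)
    exact ⟨z n, hz n⟩
  choose φ hφ using fun n => exists_clm_of_tendsto p (h n)
  refine ⟨φ, fun y => ⟨fun n => hφ n y, ?_⟩⟩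
  obtain ⟨z, hzY, hz⟩ := hB y (lp.memℓp y)
  rwa [show (fun n => φ n y) = z from funext fun n => tendsto_nhds_unique (hφ n y) (hz n)]

theorem mem_seqL_top_iff {z : ℕ → ℝ} : z ∈ seqL ∞ ↔ ∃ C, ∀ n, |z n| ≤ C := by
  simp [seqL, memℓp_infty_iff, bddAbove_def]

theorem mem_seqL_one_iff {z : ℕ → ℝ} : z ∈ seqL 1 ↔ Summable fun n => |z n| := by
  simp [seqL, memℓp_gen_iff (p := 1) (by simp)]

theorem seqC_subset_seqL_top : seqC ⊆ seqL ∞ := by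
  rintro z ⟨l, hl⟩
  have := hl.abs.bddAbove_range
  rw [mem_seqL_top_iff]
  simpa [bddAbove_def] using this

theorem matrixClass_mono {X Y Z : Set (ℕ → ℝ)} (h : Y ⊆ Z) : matrixClass X Y ⊆ matrixClass X Z :=
  fun _ hA x hx => let ⟨y, hy, hxy⟩ := hA x hx; ⟨y, h hy, hxy⟩

theorem supRowSums_of_mem_matrixClass {p : ℝ≥0∞} {q : ℝ} (h : SeqConjugate p q)
    {B : Matrix ℕ ℕ ℝ} (hB : B ∈ matrixClass (seqL p) (seqL ∞)) : SupRowSums q B := by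
  have : Fact (1 ≤ p) := ⟨h.one_le⟩
  obtain ⟨φ, hφ⟩ := exists_row_clm hB
  exact iSup_lt_top_of_pointwise_bounded h φ (fun n y => (hφ y).1 n)
    fun y => mem_seqL_top_iff.1 (hφ y).2

theorem mem_matrixClass_seqL_top_iff {p : ℝ≥0∞} {q : ℝ} (h : SeqConjugate p q)
    {B : Matrix ℕ ℕ ℝ} : B ∈ matrixClass (seqL p) (seqL ∞) ↔ SupRowSums q B := by
  refine ⟨supRowSums_of_mem_matrixClass h, fun hB y hy => ?_⟩
  obtain ⟨C, -, hC⟩ := exists_bound_of_iSup_lt_top h hB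
  have hC := fun n => hC n ⟨y, hy⟩
  exact ⟨fun n => ∑' k, B n k * y k,
    mem_seqL_top_iff.2 ⟨_, fun n => (abs_tsum_le_tsum_abs (hC n).1).trans (hC n).2⟩,
    fun n => tendsto_sum_of_summable_abs (hC n).1⟩

/-- An `l_1` norm is controlled by its subset sums up to a factor `2`, so the duality argument is
run on the functionals `∑ n ∈ K, φ n`. -/
theorem mem_matrixClass_seqL_one_iff {p : ℝ≥0∞} {q : ℝ} (h : SeqConjugate p q)
    {B : Matrix ℕ ℕ ℝ} : B ∈ matrixClass (seqL p) (seqL 1) ↔ SupFinsetSums q B := by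
  constructor
  · intro hB
    have : Fact (1 ≤ p) := ⟨h.one_le⟩
    obtain ⟨φ, hφ⟩ := exists_row_clm hB
    refine iSup_lt_top_of_pointwise_bounded h (b := fun (K : Finset ℕ) k => ∑ n ∈ K, B n k)
      (fun K => ∑ n ∈ K, φ n) (fun K y => ?_) fun y => ?_
    · simp_rw [Finset.sum_mul, sum_apply]
      simp_rw [Finset.sum_comm (t := K)]
      exact tendsto_finsetSum _ fun n _ => (hφ y).1 n
    · refine ⟨∑' n, |φ n y|, fun K => ?_⟩
      rw [sum_apply]
      exact (Finset.abs_sum_le_sum_abs _ _).trans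
        ((mem_seqL_one_iff.1 (hφ y).2).sum_le_tsum _ fun _ _ => abs_nonneg _)
  · intro hB y hy
    obtain ⟨C, -, hC⟩ := exists_bound_of_iSup_lt_top h hB
    have hC := fun K => hC K ⟨y, hy⟩
    have hrow : ∀ n, Summable fun k => |B n k * y k| := fun n => by
      simpa using (hC {n}).1
    refine ⟨fun n => ∑' k, B n k * y k, ?_, fun n => tendsto_sum_of_summable_abs (hrow n)⟩
    rw [mem_seqL_one_iff]
    refine summable_of_sum_le (fun _ => abs_nonneg _) (sum_abs_le_two_mul fun K => ?_)
      (c := 2 * (C * ‖(⟨y, hy⟩ : lp (fun _ : ℕ => ℝ) p)‖))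
    rw [← Summable.tsum_finsetSum fun n _ => (hrow n).of_abs]
    simp_rw [← Finset.sum_mul]
    exact (abs_tsum_le_tsum_abs (hC K).1).trans (hC K).2

theorem hasColLimits_of_mem_matrixClass {p : ℝ≥0∞} {B : Matrix ℕ ℕ ℝ}
    (hB : B ∈ matrixClass (seqL p) seqC) : HasColLimits B := by
  intro k
  obtain ⟨z, ⟨l, hl⟩, hz⟩ := hB _ (lp.memℓp (lp.single (E := fun _ : ℕ => ℝ) p k 1))
  refine ⟨l, hl.congr fun n => tendsto_nhds_unique (hz n) (tendsto_const_nhds.congr' ?_)⟩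
  filter_upwards [eventually_gt_atTop k] with N hN
  rw [Finset.sum_eq_single k]
  · simp
  · intro j _ hj
    simp [hj]
  · simp [hN]

/-- A matrix with `l_q`-bounded rows and convergent columns acts from `l_p`, `p < ∞`, to `c`,
and the limit of the transform is computed columnwise. -/
theorem tendsto_tsum_of_supRowSums {p : ℝ≥0∞} {q : ℝ} (h : SeqConjugate p q) (hp : p ≠ ∞)
    {B : Matrix ℕ ℕ ℝ} (hB : SupRowSums q B) {b : ℕ → ℝ}
    (hb : ∀ k, Tendsto (fun n => B n k) atTop (𝓝 (b k))) {y : ℕ → ℝ} (hy : y ∈ seqL p) :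
    Tendsto (fun N => ∑ k ∈ Finset.range N, b k * y k) atTop (𝓝 (∑' k, b k * y k)) ∧
      Tendsto (fun n => ∑' k, B n k * y k) atTop (𝓝 (∑' k, b k * y k)) := by
  have : Fact (1 ≤ p) := ⟨h.one_le⟩
  obtain ⟨C, hC0, hC⟩ := exists_bound_of_iSup_lt_top h hB
  -- The column limits inherit the bound `C`: it holds for finite sums and passes to the limit in
  -- `n`.
  have hbC : ⨆ _ : Unit, ∑' k, ‖b k‖ₑ ^ q < ∞ := by
    refine iSup_lt_top_of_forall h hC0 fun _ N u hu => ?_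
    refine le_of_tendsto
      (tendsto_finsetSum (Finset.range N) fun k _ => (hb k).mul_const (u k)).abs
      (Eventually.of_forall fun n => ?_)
    exact (Finset.abs_sum_le_sum_abs _ _).trans
      (((hC n u).1.sum_le_tsum _ fun _ _ => abs_nonneg _).trans (hC n u).2)
  obtain ⟨C', -, hC'⟩ := exists_bound_of_iSup_lt_top h hbC
  set v : lp (fun _ : ℕ => ℝ) p := ⟨y, hy⟩
  have hlim := tendsto_sum_of_summable_abs (hC' () v).1
  refine ⟨hlim, ?_⟩
  set S : ℕ → lp (fun _ : ℕ => ℝ) p := fun N => ∑ k ∈ Finset.range N, lp.single p k (v k) with hSd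
  have hS : Tendsto S atTop (𝓝 v) := (lp.hasSum_single hp v).tendsto_sum_nat
  have hSk : ∀ N k, (v - S N) k = if k < N then 0 else y k := fun N k => by
    rw [lp.coeFn_sub, Pi.sub_apply, hSd]
    simp only [lp.coeFn_sum, Finset.sum_apply, lp.single_apply, Pi.single_apply]
    simp only [Finset.sum_ite_eq, Finset.mem_range]
    split_ifs <;> simp [v]
  -- The tail beyond `N` is at most `C * ‖v - S N‖` for all `n` at once. This tends to `0` because
  -- `p < ∞`, and uniformity allows the limits in `n` and `N` to be exchanged.
  have hunif : TendstoUniformly (fun N n => ∑ k ∈ Finset.range N, B n k * y k)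
      (fun n => ∑' k, B n k * y k) atTop := by
    rw [Metric.tendstoUniformly_iff]
    intro ε hε
    have h0 : Tendsto (fun N => C * ‖v - S N‖) atTop (𝓝 0) := by
      simpa using ((tendsto_const_nhds (x := v)).sub hS).norm.const_mul C
    filter_upwards [h0.eventually (gt_mem_nhds hε)] with N hN n
    refine lt_of_le_of_lt ?_ hN
    have h1 := (abs_tsum_le_tsum_abs (hC n (v - S N)).1).trans (hC n (v - S N)).2
    convert h1 using 1
    have h2 := (hC n v).1.of_abs.tsum_sub
      (summable_of_hasFiniteSupport (f := fun k => if k < N then B n k * y k else 0)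
        ((Finset.range N).finite_toSet.subset fun k hk => by
          by_contra hkN
          exact hk (if_neg (by simpa using hkN))))
    have h3 : ∑' k, (if k < N then B n k * y k else 0) = ∑ k ∈ Finset.range N, B n k * y k := by
      rw [tsum_eq_sum (s := Finset.range N) fun k hk => if_neg (by simpa using hk)]
      exact Finset.sum_congr rfl fun k hk => if_pos (Finset.mem_range.1 hk)
    rw [h3] at h2
    rw [Real.dist_eq]
    congr 1
    refine h2.symm.trans (tsum_congr fun k => ?_)
    rw [hSk]
    split_ifs <;> simp [v]
  exact hunif.tendsto_of_eventually_tendsto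
    (Eventually.of_forall fun N =>
      tendsto_finsetSum (Finset.range N) fun k _ => (hb k).mul_const (y k)) hlim

theorem mem_matrixClass_seqC_iff {p : ℝ≥0∞} {q : ℝ} (h : SeqConjugate p q) (hp : p ≠ ∞)
    {B : Matrix ℕ ℕ ℝ} :
    B ∈ matrixClass (seqL p) seqC ↔ SupRowSums q B ∧ HasColLimits B := by
  refine ⟨fun hB => ⟨supRowSums_of_mem_matrixClass h (matrixClass_mono seqC_subset_seqL_top hB),
    hasColLimits_of_mem_matrixClass hB⟩, ?_⟩
  rintro ⟨hB, hcol⟩ y hy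
  obtain ⟨C, -, hC⟩ := exists_bound_of_iSup_lt_top h hB
  choose b hb using hcol
  exact ⟨_, ⟨_, (tendsto_tsum_of_supRowSums h hp hB hb hy).2⟩,
    fun n => tendsto_sum_of_summable_abs (hC n ⟨y, hy⟩).1⟩

/-! ### Schur's theorem -/

/-- Scheffé's argument: `|B n k| + |b k| - |B n k - b k|` lies between `0` and `2 * |b k|`, so
dominated convergence applies to it, and convergence of the norms does the rest. -/
theorem tendsto_tsum_abs_sub_of_limRowSums {B : Matrix ℕ ℕ ℝ} (hB : LimRowSums B) {b : ℕ → ℝ}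
    (hb : ∀ k, Tendsto (fun n => B n k) atTop (𝓝 (b k))) :
    (∀ n, Summable fun k => |B n k|) ∧ (Summable fun k => |b k|) ∧
      Tendsto (fun n => ∑' k, |B n k - b k|) atTop (𝓝 0) := by
  obtain ⟨b', hb', hrow, hbs, hlim⟩ := hB
  obtain rfl : b' = b := funext fun k => tendsto_nhds_unique (hb' k) (hb k)
  refine ⟨hrow, hbs, ?_⟩
  have hd : ∀ n, Summable fun k => |B n k - b' k| := fun n =>
    Summable.of_nonneg_of_le (fun _ => abs_nonneg _) (fun k => abs_sub _ _)
      ((hrow n).add hbs)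
  have h1 : Tendsto (fun n => ∑' k, (|B n k| + |b' k| - |B n k - b' k|)) atTop
      (𝓝 (∑' k, 2 * |b' k|)) := by
    refine tendsto_tsum_of_dominated_convergence (hbs.mul_left 2) (fun k => ?_)
      (Eventually.of_forall fun n k => ?_)
    · have := (((hb k).abs.add_const |b' k|).sub ((hb k).sub_const (b' k)).abs)
      simpa [two_mul] using this
    · rw [Real.norm_eq_abs, abs_le]
      have h2 := abs_sub (B n k) (b' k)
      have h3 := abs_sub_abs_le_abs_sub (B n k) (b' k)
      have h4 := abs_nonneg (b' k)
      constructor <;> linarith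
  have h2 : ∀ n, ∑' k, |B n k - b' k| =
      ∑' k, |B n k| + ∑' k, |b' k| - ∑' k, (|B n k| + |b' k| - |B n k - b' k|) := fun n => by
    rw [((hrow n).add hbs).tsum_sub (hd n), (hrow n).tsum_add hbs]
    ring
  simp_rw [h2]
  have := (hlim.add_const (∑' k, |b' k|)).sub h1
  rw [tsum_mul_left] at this
  convert this using 2
  ring

theorem tendsto_tsum_of_limRowSums {B : Matrix ℕ ℕ ℝ} (hB : LimRowSums B) {b : ℕ → ℝ}
    (hb : ∀ k, Tendsto (fun n => B n k) atTop (𝓝 (b k))) {y : ℕ → ℝ} (hy : y ∈ seqL ∞) :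
    (∀ n, Tendsto (fun N => ∑ k ∈ Finset.range N, B n k * y k) atTop (𝓝 (∑' k, B n k * y k))) ∧
    Tendsto (fun N => ∑ k ∈ Finset.range N, b k * y k) atTop (𝓝 (∑' k, b k * y k)) ∧
      Tendsto (fun n => ∑' k, B n k * y k) atTop (𝓝 (∑' k, b k * y k)) := by
  obtain ⟨hrow, hbs, hlim⟩ := tendsto_tsum_abs_sub_of_limRowSums hB hb
  obtain ⟨C, hC⟩ := mem_seqL_top_iff.1 hy
  have hle : ∀ (a : ℕ → ℝ) k, |a k * y k| ≤ |a k| * C := fun a k => by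
    rw [abs_mul]
    exact mul_le_mul_of_nonneg_left (hC k) (abs_nonneg _)
  have hsum : ∀ a : ℕ → ℝ, (Summable fun k => |a k|) → Summable fun k => |a k * y k| :=
    fun a ha => Summable.of_nonneg_of_le (fun _ => abs_nonneg _) (hle a) (ha.mul_right C)
  refine ⟨fun n => tendsto_sum_of_summable_abs (hsum _ (hrow n)),
    tendsto_sum_of_summable_abs (hsum _ hbs), ?_⟩
  have hd : ∀ n, Summable fun k => |B n k - b k| := fun n =>
    Summable.of_nonneg_of_le (fun _ => abs_nonneg _) (fun k => abs_sub _ _)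
      ((hrow n).add hbs)
  rw [tendsto_iff_dist_tendsto_zero]
  refine squeeze_zero (fun _ => dist_nonneg) (fun n => ?_) (by simpa using hlim.mul_const C)
  rw [Real.dist_eq, ← (hsum _ (hrow n)).of_abs.tsum_sub (hsum _ hbs).of_abs, ← tsum_mul_right]
  simp_rw [← sub_mul]
  exact (abs_tsum_le_tsum_abs (hsum _ (hd n))).trans
    ((hsum _ (hd n)).tsum_le_tsum (hle _) ((hd n).mul_right C))

/-- Uniform smallness off a finite set of columns, by Baire's theorem in `{-1, 1} ^ ℕ`. -/
theorem exists_finset_sum_abs_sub_le {B : Matrix ℕ ℕ ℝ} (hrow : ∀ n, Summable fun k => |B n k|)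
    (hB : ∀ y : ℕ → ℝ, y ∈ seqL ∞ → ∃ l, Tendsto (fun n => ∑' k, B n k * y k) atTop (𝓝 l))
    {ε : ℝ} (hε : 0 < ε) :
    ∃ (I : Finset ℕ) (N : ℕ), ∀ m ≥ N, ∀ n ≥ N, ∀ L : Finset ℕ, Disjoint L I →
      ∑ k ∈ L, |B n k - B m k| ≤ ε := by
  set s : Bool → ℝ := fun t => if t then 1 else -1 with hs
  have hs1 : ∀ t, |s t| = 1 := fun t => by cases t <;> simp [hs]
  have hle : ∀ n k t, ‖B n k * s t‖ ≤ |B n k| := fun n k t => by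
    rw [Real.norm_eq_abs, abs_mul, hs1, mul_one]
  set ψ : ℕ → (ℕ → Bool) → ℝ := fun n x => ∑' k, B n k * s (x k)
  have hψ : ∀ n, Continuous (ψ n) := fun n =>
    continuous_tsum (fun k => continuous_const.mul
      ((continuous_of_discreteTopology (f := s)).comp (continuous_apply k))) (hrow n)
      fun k x => hle n k _
  -- These closed sets cover the Cantor space because each sequence `ψ n x` is Cauchy. One of them
  -- therefore contains a cylinder, which constrains only the coordinates in a finite set `I`.
  set F : ℕ → Set (ℕ → Bool) := fun N => {x | ∀ m ≥ N, ∀ n ≥ N, |ψ n x - ψ m x| ≤ ε / 2} with hF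
  have hFc : ∀ N, IsClosed (F N) := fun N => by
    simp only [hF, Set.ofPred_forall]
    exact isClosed_iInter fun m => isClosed_iInter fun _ => isClosed_iInter fun n =>
      isClosed_iInter fun _ => isClosed_le ((hψ n).sub (hψ m)).abs continuous_const
  have hFU : ⋃ N, F N = Set.univ := by
    refine Set.eq_univ_of_forall fun x => Set.mem_iUnion.2 ?_
    obtain ⟨l, hl⟩ := hB (fun k => s (x k))
      (mem_seqL_top_iff.2 ⟨1, fun k => (hs1 _).le⟩)
    obtain ⟨N, hN⟩ := Metric.cauchySeq_iff.1 hl.cauchySeq (ε / 2) (by positivity)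
    exact ⟨N, fun m hm n hn => (hN n hn m hm).le⟩
  obtain ⟨N, x, hx⟩ := nonempty_interior_of_iUnion_of_closed hFc hFU
  obtain ⟨I, u, hu, hsub⟩ := isOpen_pi_iff.1 isOpen_interior x hx
  refine ⟨I, N, fun m hm n hn L hL => ?_⟩
  -- Two points of the cylinder that differ only on `L`, where their signs follow and oppose those
  -- of `B n k - B m k`. Subtracting their values leaves `2 * ∑ k ∈ L, |B n k - B m k|`.
  set xs : Bool → ℕ → Bool := fun t k =>
    if k ∈ L then (if 0 ≤ B n k - B m k then t else !t) else x k with hxs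
  have hmem : ∀ t, xs t ∈ F N := fun t => interior_subset (hsub fun k hk => by
    have : k ∉ L := fun hkL => Finset.disjoint_left.1 hL hkL hk
    simpa [hxs, this] using (hu k hk).2)
  have hsum : ∀ n (x : ℕ → Bool), Summable fun k => B n k * s (x k) := fun n x =>
    Summable.of_norm_bounded (hrow n) fun k => hle n k _
  have h1 := abs_le.1 (hmem true m hm n hn)
  have h2 := abs_le.1 (hmem false m hm n hn)
  have h3 : (ψ n (xs true) - ψ m (xs true)) - (ψ n (xs false) - ψ m (xs false)) =
      ∑ k ∈ L, 2 * |B n k - B m k| := by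
    simp only [ψ]
    rw [← (hsum n _).tsum_sub (hsum m _), ← (hsum n _).tsum_sub (hsum m _),
      ← ((hsum n _).sub (hsum m _)).tsum_sub ((hsum n _).sub (hsum m _)), tsum_eq_sum (s := L)]
    · refine Finset.sum_congr rfl fun k hk => ?_
      by_cases h0 : 0 ≤ B n k - B m k
      · simp only [hxs, hs, hk, h0, if_true, abs_of_nonneg h0]
        simp
        ring
      · simp only [hxs, hs, hk, h0, if_true, if_false, abs_of_neg (not_le.1 h0)]
        simp
        ring
    · intro k hk
      simp [hxs, hk]
  rw [← Finset.mul_sum] at h3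
  linarith [h1.2, h2.1]

theorem limRowSums_of_mem_matrixClass {B : Matrix ℕ ℕ ℝ}
    (hB : B ∈ matrixClass (seqL ∞) seqC) : LimRowSums B := by
  obtain ⟨C, -, hC⟩ := exists_bound_of_iSup_lt_top SeqConjugate.top
    (supRowSums_of_mem_matrixClass SeqConjugate.top (matrixClass_mono seqC_subset_seqL_top hB))
  have h1 : (fun _ : ℕ => (1 : ℝ)) ∈ seqL ∞ := mem_seqL_top_iff.2 ⟨1, by simp⟩
  have hrow : ∀ n, Summable fun k => |B n k| := fun n => by simpa using (hC n ⟨_, h1⟩).1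
  have hrowC : ∀ n, ∑' k, |B n k| ≤ C * ‖(⟨_, h1⟩ : lp (fun _ : ℕ => ℝ) ∞)‖ := fun n => by
    simpa using (hC n ⟨_, h1⟩).2
  have hlim : ∀ y : ℕ → ℝ, y ∈ seqL ∞ → ∃ l, Tendsto (fun n => ∑' k, B n k * y k) atTop (𝓝 l) := by
    intro y hy
    obtain ⟨z, ⟨l, hl⟩, hz⟩ := hB y hy
    exact ⟨l, hl.congr fun n =>
      tendsto_nhds_unique (hz n) (tendsto_sum_of_summable_abs (hC n ⟨y, hy⟩).1)⟩
  choose b hb using hasColLimits_of_mem_matrixClass hB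
  have hbs : Summable fun k => |b k| := by
    refine summable_of_sum_le (fun _ => abs_nonneg _) fun K =>
      le_of_tendsto (tendsto_finsetSum K fun k _ => (hb k).abs) (Eventually.of_forall fun n =>
        ((hrow n).sum_le_tsum K fun _ _ => abs_nonneg _).trans (hrowC n))
  have hd : ∀ n, Summable fun k => |B n k - b k| := fun n =>
    Summable.of_nonneg_of_le (fun _ => abs_nonneg _) (fun k => abs_sub _ _)
      ((hrow n).add hbs)
  refine ⟨b, hb, hrow, hbs, ?_⟩
  -- Off the finite set `I` the Baire estimate is used with `m → ∞`; on `I` the columns converge.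
  have hmain : Tendsto (fun n => ∑' k, |B n k - b k|) atTop (𝓝 0) := by
    rw [Metric.tendsto_atTop']
    intro ε hε
    obtain ⟨I, N, hIN⟩ := exists_finset_sum_abs_sub_le hrow hlim (show 0 < ε / 3 by positivity)
    have hI : Tendsto (fun n => ∑ k ∈ I, |B n k - b k|) atTop (𝓝 0) := by
      have := tendsto_finsetSum I fun k _ => ((hb k).sub_const (b k)).abs
      simpa using this
    obtain ⟨M, hM⟩ := eventually_atTop.1 (hI.eventually (gt_mem_nhds (show 0 < ε / 3 by positivity)))
    refine ⟨max M N, fun n hn => ?_⟩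
    have hnM := hM n ((le_max_left _ _).trans hn.le)
    rw [Real.dist_eq, sub_zero, abs_of_nonneg (tsum_nonneg fun _ => abs_nonneg _)]
    refine ((hd n).tsum_le_of_sum_le (a₂ := ε / 3 + ε / 3) fun L => ?_).trans_lt (by linarith)
    have h2 : ∑ k ∈ L \ I, |B n k - b k| ≤ ε / 3 := by
      refine le_of_tendsto
        (tendsto_finsetSum (L \ I) fun k _ => ((hb k).const_sub (B n k)).abs)
        ((eventually_ge_atTop N).mono fun m hm =>
          hIN m hm n ((le_max_right _ _).trans hn.le) _ Finset.sdiff_disjoint)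
    have h3 : ∑ k ∈ L ∩ I, |B n k - b k| ≤ ∑ k ∈ I, |B n k - b k| :=
      Finset.sum_le_sum_of_subset_of_nonneg Finset.inter_subset_right fun _ _ _ => abs_nonneg _
    rw [← Finset.sum_inter_add_sum_sdiff L I]
    linarith
  rw [tendsto_iff_dist_tendsto_zero]
  refine squeeze_zero (fun _ => dist_nonneg) (fun n => ?_) hmain
  rw [Real.dist_eq, ← (hrow n).tsum_sub hbs]
  have h4 : ∀ k, |(|B n k| - |b k|)| ≤ |B n k - b k| := fun k => abs_abs_sub_abs_le_abs_sub _ _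
  have h5 := Summable.of_nonneg_of_le (fun _ => abs_nonneg _) h4 (hd n)
  exact (abs_tsum_le_tsum_abs h5).trans (h5.tsum_le_tsum h4 (hd n))

theorem mem_matrixClass_seqL_top_seqC_iff {B : Matrix ℕ ℕ ℝ} :
    B ∈ matrixClass (seqL ∞) seqC ↔ LimRowSums B := by
  refine ⟨limRowSums_of_mem_matrixClass, fun hB y hy => ?_⟩
  obtain ⟨b, hb, -⟩ := id hB
  obtain ⟨h1, -, h2⟩ := tendsto_tsum_of_limRowSums hB hb hy
  exact ⟨_, ⟨_, h2⟩, h1⟩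

theorem LimRowSums.hasColLimits {B : Matrix ℕ ℕ ℝ} (hB : LimRowSums B) : HasColLimits B :=
  let ⟨b, hb, _⟩ := hB
  fun k => ⟨b k, hb k⟩

/-! ### Inverting the Fibonacci band matrix -/

theorem fibSeq_pos (n : ℕ) : 0 < fibSeq n := by
  simp [fibSeq, Nat.fib_pos]

/-- The entries on and below the diagonal of the inverse of `fibMatrix r s`. -/
noncomputable def fibInv (r s : ℝ) (n k : ℕ) : ℝ :=
  1 / r * (-(s / r)) ^ (n - k) * (fibSeq (n + 1) ^ 2 / (fibSeq k * fibSeq (k + 1)))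

theorem fibInv_self (r s : ℝ) (n : ℕ) : fibInv r s n n = 1 / r * (fibSeq (n + 1) / fibSeq n) := by
  have h0 := (fibSeq_pos n).ne'
  have h1 := (fibSeq_pos (n + 1)).ne'
  simp only [fibInv, Nat.sub_self, pow_zero]
  field_simp

theorem fibInv_succ {r s : ℝ} {n k : ℕ} (hk : k ≤ n) :
    fibInv r s (n + 1) k =
      -(s / r) * (fibSeq (n + 2) ^ 2 / fibSeq (n + 1) ^ 2) * fibInv r s n k := by
  have h0 := (fibSeq_pos k).ne'
  have h1 := (fibSeq_pos (k + 1)).ne'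
  have h2 := (fibSeq_pos (n + 1)).ne'
  simp only [fibInv, Nat.succ_sub hk, Nat.succ_eq_add_one, pow_succ]
  rw [show n + 1 + 1 = n + 2 from rfl]
  field_simp

theorem isTransform_fibMatrix_iff {r s : ℝ} {x y : ℕ → ℝ} :
    IsTransform (fibMatrix r s) x y ↔ y 0 = r * (fibSeq 0 / fibSeq 1) * x 0 ∧
      ∀ n, y (n + 1) = s * (fibSeq (n + 2) / fibSeq (n + 1)) * x n +
        r * (fibSeq (n + 1) / fibSeq (n + 2)) * x (n + 1) := by
  have key : ∀ n, Tendsto (fun N => ∑ k ∈ Finset.range N, fibMatrix r s n k * x k) atTop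
      (𝓝 (∑ k ∈ Finset.range (n + 1), fibMatrix r s n k * x k)) := fun n => by
    refine tendsto_const_nhds.congr' ?_
    filter_upwards [eventually_ge_atTop (n + 1)] with N hN
    refine Finset.sum_subset (Finset.range_mono hN) fun k _ hk => ?_
    have : n < k := by simpa using hk
    rw [fibMatrix, if_neg (by omega), if_neg (by omega), zero_mul]
  have key2 : IsTransform (fibMatrix r s) x y ↔
      ∀ n, y n = ∑ k ∈ Finset.range (n + 1), fibMatrix r s n k * x k :=
    ⟨fun h n => tendsto_nhds_unique (h n) (key n), fun h n => by rw [h n]; exact key n⟩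
  have hz : fibMatrix r s 0 0 = r * (fibSeq 0 / fibSeq 1) := by simp [fibMatrix]
  have hsucc : ∀ n, ∑ k ∈ Finset.range (n + 2), fibMatrix r s (n + 1) k * x k =
      s * (fibSeq (n + 2) / fibSeq (n + 1)) * x n +
        r * (fibSeq (n + 1) / fibSeq (n + 2)) * x (n + 1) := fun n => by
    rw [Finset.sum_range_succ, Finset.sum_range_succ, Finset.sum_eq_zero]
    · simp [fibMatrix]
    · intro k hk
      have : k < n := by simpa using hk
      rw [fibMatrix, if_neg (by omega), if_neg (by omega), zero_mul]
  rw [key2]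
  constructor
  · intro h
    exact ⟨by simpa [hz] using h 0, fun n => (h (n + 1)).trans (hsucc n)⟩
  · rintro ⟨h0, h⟩ (_ | n)
    · simpa [hz] using h0
    · exact (h n).trans (hsucc n).symm

/-- `fibInv r s` inverts `fibMatrix r s`. -/
theorem isTransform_fibMatrix_iff_eq_sum {r s : ℝ} (hr : r ≠ 0) {x y : ℕ → ℝ} :
    IsTransform (fibMatrix r s) x y ↔
      ∀ n, x n = ∑ k ∈ Finset.range (n + 1), fibInv r s n k * y k := by
  have hf := fun n => (fibSeq_pos n).ne'
  -- The candidate inverse satisfies the first-order recursion that `F̂x = y` imposes on `x`.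
  have hstep : ∀ n, ∑ k ∈ Finset.range (n + 2), fibInv r s (n + 1) k * y k =
      -(s / r) * (fibSeq (n + 2) ^ 2 / fibSeq (n + 1) ^ 2) *
        (∑ k ∈ Finset.range (n + 1), fibInv r s n k * y k) +
      1 / r * (fibSeq (n + 2) / fibSeq (n + 1)) * y (n + 1) := fun n => by
    rw [Finset.sum_range_succ, fibInv_self, Finset.mul_sum]
    congr 1
    refine Finset.sum_congr rfl fun k hk => ?_
    rw [fibInv_succ (Nat.lt_succ_iff.1 (Finset.mem_range.1 hk)), mul_assoc]
  rw [isTransform_fibMatrix_iff]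
  constructor
  · rintro ⟨h0, h⟩ n
    induction n with
    | zero =>
      have := hf 0
      have := hf 1
      simp only [zero_add, Finset.sum_range_one, fibInv_self, h0]
      field_simp
    | succ n ih =>
      have := hf (n + 1)
      have := hf (n + 2)
      rw [hstep, ← ih, h]
      field_simp
      ring
  · intro h
    refine ⟨?_, fun n => ?_⟩
    · have := hf 0
      have := hf 1
      simp only [h 0, zero_add, Finset.sum_range_one, fibInv_self]
      field_simp
    · have := hf (n + 1)
      have := hf (n + 2)
      rw [h (n + 1), hstep, ← h n]
      field_simp
      ring

/-! ### Reduction to `l_p` through the matrices `D^{(m)}` and `D` -/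

theorem matDm_eq_sum (r s : ℝ) (A : Matrix ℕ ℕ ℝ) (n m k : ℕ) :
    matDm r s A n m k = ∑ j ∈ Finset.Icc k m, fibInv r s j k * A n j := by
  unfold matDm fibInv
  split_ifs with h
  · rfl
  · rw [Finset.Icc_eq_empty h, Finset.sum_empty]

theorem matD_eq_of_tendsto {r s : ℝ} {A : Matrix ℕ ℕ ℝ} {n k : ℕ} {l : ℝ}
    (h : Tendsto (fun m => matDm r s A n m k) atTop (𝓝 l)) : matD r s A n k = l := by
  simp_rw [matDm_eq_sum] at h
  exact h.limUnder_eq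

theorem tendsto_matD {r s : ℝ} {A : Matrix ℕ ℕ ℝ} {n : ℕ} (h : HasColLimits (matDm r s A n))
    (k : ℕ) : Tendsto (fun m => matDm r s A n m k) atTop (𝓝 (matD r s A n k)) := by
  obtain ⟨l, hl⟩ := h k
  rwa [matD_eq_of_tendsto hl]

theorem sum_matDm_mul {r s : ℝ} {x y : ℕ → ℝ}
    (h : ∀ n, x n = ∑ k ∈ Finset.range (n + 1), fibInv r s n k * y k)
    (A : Matrix ℕ ℕ ℝ) (n m : ℕ) :
    ∑ k ∈ Finset.range (m + 1), matDm r s A n m k * y k =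
      ∑ j ∈ Finset.range (m + 1), A n j * x j := by
  simp_rw [matDm_eq_sum, h, Finset.mul_sum, Finset.sum_mul]
  rw [Finset.sum_comm' (t' := Finset.range (m + 1)) (s' := fun j => Finset.range (j + 1))]
  · exact Finset.sum_congr rfl fun j _ => Finset.sum_congr rfl fun k _ => by ring
  · intro k j
    simp only [Finset.mem_range, Finset.mem_Icc]
    omega

theorem tendsto_matDm_row (r s : ℝ) (A : Matrix ℕ ℕ ℝ) (n : ℕ) (y : ℕ → ℝ) :
    IsTransform (matDm r s A n) y
      fun m => ∑ k ∈ Finset.range (m + 1), matDm r s A n m k * y k := fun m => by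
  refine tendsto_const_nhds.congr' ?_
  filter_upwards [eventually_ge_atTop (m + 1)] with N hN
  refine Finset.sum_subset (Finset.range_mono hN) fun k _ hk => ?_
  rw [matDm, if_neg (by simpa [Nat.lt_succ_iff] using hk), zero_mul]

/-- A matrix acts from the domain of `fibMatrix r s` in `l_p` to `Y` if and only if the `matDm`
act from `l_p` to `c` and `matD` acts from `l_p` to `Y`. -/
theorem mem_matrixClass_fibL_iff {p : ℝ≥0∞} {r s : ℝ} (hr : r ≠ 0)
    (hp : ∀ B : Matrix ℕ ℕ ℝ, B ∈ matrixClass (seqL p) seqC → ∀ b : ℕ → ℝ,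
      (∀ k, Tendsto (fun n => B n k) atTop (𝓝 (b k))) → ∀ y ∈ seqL p, ∀ z,
      IsTransform B y z → ∃ l : ℝ,
        Tendsto (fun N => ∑ k ∈ Finset.range N, b k * y k) atTop (𝓝 l) ∧ Tendsto z atTop (𝓝 l))
    (A : Matrix ℕ ℕ ℝ) (Y : Set (ℕ → ℝ)) :
    A ∈ matrixClass (fibL p r s) Y ↔
      (∀ n, matDm r s A n ∈ matrixClass (seqL p) seqC) ∧
        matD r s A ∈ matrixClass (seqL p) Y := by
  constructor
  · intro hA
    have key : ∀ y ∈ seqL p, ∃ w ∈ Y, ∀ n, Tendsto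
        (fun m => ∑ k ∈ Finset.range (m + 1), matDm r s A n m k * y k) atTop (𝓝 (w n)) := by
      intro y hy
      obtain ⟨w, hw, hAw⟩ := hA (fun n => ∑ k ∈ Finset.range (n + 1), fibInv r s n k * y k)
        ⟨y, hy, (isTransform_fibMatrix_iff_eq_sum hr).2 fun _ => rfl⟩
      refine ⟨w, hw, fun n => ?_⟩
      simp_rw [sum_matDm_mul (fun _ => rfl) A n]
      -- The sums up to `m` run over `range (m + 1)`, a shift that does not affect the limit.
      exact (tendsto_add_atTop_iff_nat 1).2 (hAw n)
    have hDm : ∀ n, matDm r s A n ∈ matrixClass (seqL p) seqC := fun n y hy => by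
      obtain ⟨w, -, hw⟩ := key y hy
      exact ⟨_, ⟨w n, hw n⟩, tendsto_matDm_row r s A n y⟩
    refine ⟨hDm, fun y hy => ?_⟩
    obtain ⟨w, hwY, hw⟩ := key y hy
    refine ⟨w, hwY, fun n => ?_⟩
    -- `hp` equates the limit of the row transforms, which is `w n`, with the sum of the series `∑
    -- k, d_{nk} y_k`.
    obtain ⟨l, hl, hl'⟩ := hp _ (hDm n) _ (tendsto_matD (hasColLimits_of_mem_matrixClass (hDm n)))
      y hy _ (tendsto_matDm_row r s A n y)
    rwa [tendsto_nhds_unique (hw n) hl']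
  · rintro ⟨hDm, hD⟩ x ⟨y, hy, hxy⟩
    obtain ⟨w, hwY, hw⟩ := hD y hy
    refine ⟨w, hwY, fun n => ?_⟩
    obtain ⟨l, hl, hl'⟩ := hp _ (hDm n) _ (tendsto_matD (hasColLimits_of_mem_matrixClass (hDm n)))
      y hy _ (tendsto_matDm_row r s A n y)
    rw [tendsto_nhds_unique (hw n) hl]
    simp_rw [sum_matDm_mul ((isTransform_fibMatrix_iff_eq_sum hr).1 hxy) A n] at hl'
    exact (tendsto_add_atTop_iff_nat 1).1 hl'

theorem mem_matrixClass_fibL_iff_of_ne_top {p : ℝ≥0∞} {q : ℝ} (h : SeqConjugate p q)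
    (hp : p ≠ ∞) {r s : ℝ} (hr : r ≠ 0) (A : Matrix ℕ ℕ ℝ) (Y : Set (ℕ → ℝ)) :
    A ∈ matrixClass (fibL p r s) Y ↔
      (∀ n, SupRowSums q (matDm r s A n)) ∧ (∀ n, HasColLimits (matDm r s A n)) ∧
        matD r s A ∈ matrixClass (seqL p) Y := by
  rw [mem_matrixClass_fibL_iff hr]
  · simp_rw [mem_matrixClass_seqC_iff h hp, forall_and, and_assoc]
  · intro B hB b hb y hy z hz
    have hsup := ((mem_matrixClass_seqC_iff h hp).1 hB).1
    obtain ⟨C, -, hC⟩ := exists_bound_of_iSup_lt_top h hsup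
    obtain ⟨h1, h2⟩ := tendsto_tsum_of_supRowSums h hp hsup hb hy
    exact ⟨_, h1, h2.congr fun n =>
      tendsto_nhds_unique (tendsto_sum_of_summable_abs (hC n ⟨y, hy⟩).1) (hz n)⟩

theorem mem_matrixClass_fibL_top_iff {r s : ℝ} (hr : r ≠ 0) (A : Matrix ℕ ℕ ℝ)
    (Y : Set (ℕ → ℝ)) :
    A ∈ matrixClass (fibL ∞ r s) Y ↔
      (∀ n, HasColLimits (matDm r s A n)) ∧ (∀ n, LimRowSums (matDm r s A n)) ∧
        matD r s A ∈ matrixClass (seqL ∞) Y := by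
  rw [mem_matrixClass_fibL_iff hr]
  · simp_rw [mem_matrixClass_seqL_top_seqC_iff]
    exact ⟨fun h => ⟨fun n => (h.1 n).hasColLimits, h⟩, fun h => h.2⟩
  · intro B hB b hb y hy z hz
    obtain ⟨h0, h1, h2⟩ :=
      tendsto_tsum_of_limRowSums (mem_matrixClass_seqL_top_seqC_iff.1 hB) hb hy
    exact ⟨_, h1, h2.congr fun n => tendsto_nhds_unique (h0 n) (hz n)⟩

theorem corollary4p3 (r s : ℝ) (hr : r ≠ 0) (hs : s ≠ 0) (A : Matrix ℕ ℕ ℝ) :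
    (∀ p : ℝ, 1 < p →
      (A ∈ matrixClass (fibL (ENNReal.ofReal p) r s) seqC ↔
        (∀ n, SupRowSums (p / (p - 1)) (matDm r s A n)) ∧
        (∀ n, HasColLimits (matDm r s A n)) ∧
        SupRowSums (p / (p - 1)) (matD r s A) ∧
        HasColLimits (matD r s A))) ∧
    (∀ p : ℝ, 1 < p →
      (A ∈ matrixClass (fibL (ENNReal.ofReal p) r s) (seqL 1) ↔
        (∀ n, SupRowSums (p / (p - 1)) (matDm r s A n)) ∧
        (∀ n, HasColLimits (matDm r s A n)) ∧
        SupFinsetSums (p / (p - 1)) (matD r s A))) ∧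
    (A ∈ matrixClass (fibL ∞ r s) seqC ↔
        (∀ n, HasColLimits (matDm r s A n)) ∧
        (∀ n, LimRowSums (matDm r s A n)) ∧
        HasColLimits (matD r s A) ∧
        LimRowSums (matD r s A)) ∧
    (∀ p : ℝ, 1 < p →
      (A ∈ matrixClass (fibL (ENNReal.ofReal p) r s) (seqL ∞) ↔
        (∀ n, SupRowSums (p / (p - 1)) (matDm r s A n)) ∧
        (∀ n, HasColLimits (matDm r s A n)) ∧
        SupRowSums (p / (p - 1)) (matD r s A))) ∧
    (A ∈ matrixClass (fibL ∞ r s) (seqL 1) ↔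
        (∀ n, HasColLimits (matDm r s A n)) ∧
        (∀ n, LimRowSums (matDm r s A n)) ∧
        SupFinsetSums 1 (matD r s A)) ∧
    (A ∈ matrixClass (fibL ∞ r s) (seqL ∞) ↔
        (∀ n, HasColLimits (matDm r s A n)) ∧
        (∀ n, LimRowSums (matDm r s A n)) ∧
        SupRowSums 1 (matD r s A))
 := by
  refine ⟨fun p hp => ?_, fun p hp => ?_, ?_, fun p hp => ?_, ?_, ?_⟩
  · have h := SeqConjugate.of_one_lt hp
    rw [mem_matrixClass_fibL_iff_of_ne_top h ENNReal.ofReal_ne_top hr,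
      mem_matrixClass_seqC_iff h ENNReal.ofReal_ne_top]
  · have h := SeqConjugate.of_one_lt hp
    rw [mem_matrixClass_fibL_iff_of_ne_top h ENNReal.ofReal_ne_top hr,
      mem_matrixClass_seqL_one_iff h]
  · rw [mem_matrixClass_fibL_top_iff hr, mem_matrixClass_seqL_top_seqC_iff]
    -- Condition 5 is already contained in condition 6.
    exact ⟨fun h => ⟨h.1, h.2.1, h.2.2.hasColLimits, h.2.2⟩, fun h => ⟨h.1, h.2.1, h.2.2.2⟩⟩
  · have h := SeqConjugate.of_one_lt hp
    rw [mem_matrixClass_fibL_iff_of_ne_top h ENNReal.ofReal_ne_top hr,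
      mem_matrixClass_seqL_top_iff h]
  · rw [mem_matrixClass_fibL_top_iff hr, mem_matrixClass_seqL_one_iff SeqConjugate.top]
  · rw [mem_matrixClass_fibL_top_iff hr, mem_matrixClass_seqL_top_iff SeqConjugate.top]
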